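/- Let $d\ge 1$, $\mathcal I=\{1,\dots,d\}$, $\mathcal I_{-j}=\mathcal I\setminus\{j\}$. Let $\mathbf Z=(Z_1,\dots,Z_d)$ and $\mathbf Z^*=(Z_1^*,\dots,Z_d^*)$ be jointly Gaussian with zero means and unit variances, let $V_0$ be a unit exponential random variable independent of $(\mathbf Z,\mathbf Z^*)$, let $\alpha_1,\dots,\alpha_d>0$ and $c_1,\dots,c_d\in\mathbb R$, and let $$X_i=Z_i+\frac1{\alpha_i}\,V_0\,\mathbf 1(Z_i^*>c_i),\qquad i\in\mathcal I .$$ Assume that $c_1=\dots=c_d=c_0$ and $Z_1^*=\dots=Z_d^*=Z_0^*$, and put $\rho_{i,j}=\mathrm{Cor}(Z_i,Z_j)$, $\rho_{j,0}=\mathrm{Cor}(Z_j,Z_0^*)$. With $\Phi$ the standard normal distribution function, let $$\lambda_{ij}=(\alpha_i^2-2\rho_{i,j}\alpha_i\alpha_j+\alpha_j^2)^{1/2},\qquad \tilde x_j=\frac{x_j}{\Phi(\alpha_j\rho_{j,0}-c_0)},\qquad \boldsymbol\delta_j=\Big(\frac{\alpha_i\rho_{i,0}-\alpha_j\rho_{j,0}}{\lambda_{ij}}\Big)_{i\in\mathcal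 I_{-j}},$$ and let $\bar\Sigma^{(j)}$ be the matrix indexed by $\mathcal I_{-j}$ with unit diagonal and entries $(\lambda_{kj}^2+\lambda_{ij}^2-\lambda_{ki}^2)/(2\lambda_{kj}\lambda_{ij})$ for $i\neq k$. Assume that these parameters are well defined: $\lambda_{ij}>0$ for $i\ne j$, and for every $j$ the matrix $\bar\Sigma^{(j)}$ is invertible and $\boldsymbol\delta_j^\top\bar\Sigma^{(j)-1}\boldsymbol\delta_j<1$. Then the stable tail dependence function of $\mathbf X$, that is, $$\ell_{\mathbf X}(\mathbf x)=\lim_{n\to\infty}n\Big\{1-C\Big(1-\frac{x_1}n,\dots,1-\frac{x_d}n\Big)\Big\},\qquad \mathbf x\in[0,\infty)^d,$$ with $C$ the copula of $\mathbf X$, exists and is given by $$\ell_{\mathbf X}(\mathbf x)=\sum_{j=1}^d x_j\,\Phi^{\mathrm{ESN}}_{d-1}\left\{\Big(\frac{\lambda_{ij}}2+\frac1{\lambda_{ij}}\log\frac{\tilde x_j}{\tilde x_i}\Big)_{i\in\mathcal I_{-j}};\ \bar\Sigma^{(j)},\ \frac{\bar\Sigma^{(j)-1}\boldsymbol\delta_j}{\sqrt{1-\boldsymbol\delta_j^\top\bar\Sigma^{(j)-1}\boldsymbol\delta_j}},\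 \frac{\alpha_j\rho_{j,0}-c_0}{\sqrt{1-\boldsymbol\delta_j^\top\bar\Sigma^{(j)-1}\boldsymbol\delta_j}}\right\},$$ where a coordinate of the argument with $x_i=0$ is read as $+\infty$, and a summand with $x_j=0$ is $0$. Here $\Phi^{\mathrm{ESN}}_{k}(\cdot;\Sigma,\mathbf a,\tau)$ is the distribution function of the centered extended skew-normal law on $\mathbb R^k$ whose density, for a correlation matrix $\Sigma$, is $\phi_k(\mathbf y;\Sigma)\,\Phi(\mathbf a^\top\mathbf y+\tau)/\Phi\big(\tau/\sqrt{1+\mathbf a^\top\Sigma\,\mathbf a}\big)$, with $\phi_k(\cdot;\Sigma)$ the $N(\mathbf 0,\Sigma)$ density; for $k=0$ it equals $1$. -/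

import Mathlib

open MeasureTheory ProbabilityTheory Filter Topology Matrix

noncomputable section

/-! ### Stable tail dependence functions -/

/-- The generalized inverse `F⁻¹(u) = inf {x : u ≤ F(x)}` of a distribution function, with values
in the extended reals (so that `F⁻¹(1) = +∞` when `F < 1` everywhere). -/
def quantile (F : ℝ → ℝ) (u : ℝ) : EReal :=
  sInf ((fun x : ℝ => (x : EReal)) '' {x : ℝ | u ≤ F x})

/-- The copula `C(u) = F(F₁⁻¹(u₁), …, F_d⁻¹(u_d))` of the random vector `X`, where `F` is the joint
distribution function of `X` and `F₁, …, F_d` are its margins. -/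
def copula {Ω : Type*} [MeasurableSpace Ω] (P : Measure Ω) {d : ℕ} (X : Fin d → Ω → ℝ)
    (u : Fin d → ℝ) : ℝ :=
  P.real {ω | ∀ i, (X i ω : EReal) ≤ quantile (cdf (P.map (X i))) (u i)}

/-- `l` is the stable tail dependence function of `X`:
`n (1 - C(1 - x₁/n, …, 1 - x_d/n)) → l(x)` as `n → ∞`, for every `x ∈ [0, ∞)^d`,
where `C` is the copula of `X`. -/
def IsStableTailDependenceFunction {Ω : Type*} [MeasurableSpace Ω] (P : Measure Ω) {d : ℕ}
    (X : Fin d → Ω → ℝ) (l : (Fin d → ℝ) → ℝ) : Prop :=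
  ∀ x : Fin d → ℝ, (∀ i, 0 ≤ x i) →
    Tendsto (fun n : ℕ => (n : ℝ) * (1 - copula P X (fun i => 1 - x i / (n : ℝ))))
      atTop (𝓝 (l x))

/-! ### The additive factor model -/

/-- The additive factor model `X_i = Z_i + (1/α_i) · V₀ · 1(Z*_i > c_i)`. -/
def factorModel {Ω : Type*} {d : ℕ} (α c : Fin d → ℝ) (Z Zs : Fin d → Ω → ℝ) (V₀ : Ω → ℝ)
    (i : Fin d) (ω : Ω) : ℝ :=
  Z i ω + 1 / α i * V₀ ω * Set.indicator {ω' | c i < Zs i ω'} (fun _ => (1 : ℝ)) ω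

/-- The correlation coefficient of two real random variables. -/
def correlation {Ω : Type*} [MeasurableSpace Ω] (P : Measure Ω) (X Y : Ω → ℝ) : ℝ :=
  cov[X, Y; P] / (√(Var[X; P]) * √(Var[Y; P]))

/-! ### The extended skew-normal distribution -/

/-- The standard normal distribution function `Φ`. -/
def stdNormalCdf (x : ℝ) : ℝ := cdf (gaussianReal 0 1) x

/-- The correlation matrix of a covariance matrix `S`. -/
def correlationMatrix {ι : Type*} (S : Matrix ι ι ℝ) : Matrix ι ι ℝ :=
  Matrix.of fun i k => S i k / (√(S i i) * √(S k k))

/-- The centered extended skew-normal law with covariance matrix `S`, skewness vector `a` and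
extension parameter `τ`. For positive definite `S` its Lebesgue density is
`φ(y; S) Φ(aᵀ z + τ) / Φ(τ / √(1 + aᵀ S₀ a))`, where `φ(·; S)` is the `N(0, S)` density,
`z_i = y_i / √(S i i)` and `S₀` is the correlation matrix of `S`; here `φ(y; S) dy` is written as
the Gaussian measure `N(0, S)`. -/
def esnMeasure {ι : Type*} [Fintype ι] [DecidableEq ι] (S : Matrix ι ι ℝ) (a : ι → ℝ) (τ : ℝ) :
    Measure (EuclideanSpace ℝ ι) :=
  (multivariateGaussian 0 S).withDensity fun y =>
    ENNReal.ofReal (stdNormalCdf (a ⬝ᵥ (fun i => y i / √(S i i)) + τ) /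
      stdNormalCdf (τ / √(1 + a ⬝ᵥ (correlationMatrix S *ᵥ a))))

/-- The distribution function of the centered extended skew-normal law, at a point whose
coordinates may be `±∞`. -/
def esnCdf {ι : Type*} [Fintype ι] [DecidableEq ι] (S : Matrix ι ι ℝ) (a : ι → ℝ) (τ : ℝ)
    (q : ι → EReal) : ℝ :=
  (esnMeasure S a τ).real {y | ∀ i, (y i : EReal) ≤ q i}

/-! ### The parameters of the limit

`α` are the scales, `ρ i j = Cor(Z_i, Z_j)`, `ρ₀ i = Cor(Z_i, Z₀*)`, and `{i // i ≠ j}` is the index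
set `{1, …, d} \ {j}`. -/

/-- `λ_ij = (α_i² - 2 ρ_ij α_i α_j + α_j²)^{1/2}`. -/
def hrLambda {d : ℕ} (α : Fin d → ℝ) (ρ : Fin d → Fin d → ℝ) (i j : Fin d) : ℝ :=
  √(α i ^ 2 - 2 * ρ i j * α i * α j + α j ^ 2)

/-- The Hüsler–Reiss partial correlation matrix, with entries
`(λ_kj² + λ_ij² - λ_ki²) / (2 λ_kj λ_ij)` off the diagonal and `1` on the diagonal. -/
def hrMatrix {d : ℕ} (α : Fin d → ℝ) (ρ : Fin d → Fin d → ℝ) (j : Fin d) :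
    Matrix {i : Fin d // i ≠ j} {i : Fin d // i ≠ j} ℝ :=
  Matrix.of fun i k => if i = k then 1 else
    (hrLambda α ρ k j ^ 2 + hrLambda α ρ i j ^ 2 - hrLambda α ρ k i ^ 2) /
      (2 * hrLambda α ρ k j * hrLambda α ρ i j)

/-- `δ_j = ((α_i ρ_i0 - α_j ρ_j0) / λ_ij)_{i ≠ j}`. -/
def skewDelta {d : ℕ} (α : Fin d → ℝ) (ρ : Fin d → Fin d → ℝ) (ρ₀ : Fin d → ℝ) (j : Fin d) :
    {i : Fin d // i ≠ j} → ℝ :=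
  fun i => (α i * ρ₀ i - α j * ρ₀ j) / hrLambda α ρ i j

/-- The quadratic form `δ_jᵀ Σ̄⁻¹ δ_j`, where `Σ̄` is the partial correlation matrix. -/
def skewQuad {d : ℕ} (α : Fin d → ℝ) (ρ : Fin d → Fin d → ℝ) (ρ₀ : Fin d → ℝ) (j : Fin d) : ℝ :=
  skewDelta α ρ ρ₀ j ⬝ᵥ ((hrMatrix α ρ j)⁻¹ *ᵥ skewDelta α ρ ρ₀ j)

/-- `x̃_j = x_j / Φ(α_j ρ_j0 - c₀)`. -/
def xTilde {d : ℕ} (α : Fin d → ℝ) (ρ₀ : Fin d → ℝ) (c₀ : ℝ) (x : Fin d → ℝ) (j : Fin d) : ℝ :=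
  x j / stdNormalCdf (α j * ρ₀ j - c₀)

/-- The argument `(λ_ij/2 + (1/λ_ij) log(x̃_j / x̃_i))_{i ≠ j}`, read as `+∞` when `x_i = 0`. -/
def esnArgument {d : ℕ} (α : Fin d → ℝ) (ρ : Fin d → Fin d → ℝ) (ρ₀ : Fin d → ℝ) (c₀ : ℝ)
    (x : Fin d → ℝ) (j : Fin d) : {i : Fin d // i ≠ j} → EReal :=
  fun i => if x i = 0 then ⊤ else
    ((hrLambda α ρ i j / 2 +
      1 / hrLambda α ρ i j * Real.log (xTilde α ρ₀ c₀ x j / xTilde α ρ₀ c₀ x i) : ℝ) : EReal)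

end

/-! Given the Gaussian part, `exp(-V)` is uniform. On `c < Y` the event that some `exp(-α_i X_i) <
b_i` is `exp(-V) < max_i b_i exp(α_i Z_i)`, because multiplying by `α_i` makes the factor enter
every coordinate equally. Its conditional probability is the maximum capped at 1. Off `c < Y` only
the lighter Gaussian tail remains, which is negligible. Dominated convergence with a log-normal
majorant (`tendsto_mul_measureReal_exists_exp_lt`) gives the rescaled joint tail; its one-coordinate
case gives marginal tails `K_i b` and hence levels `b_i ~ x_i / (K_i n)`. So `ℓ(x) = E[1(c < Y)
max_i (x_i / K_i) exp(α_i Z_i)]` (`tendsto_mul_one_sub_copula`).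

This expectation is split according to the maximizing index `j` (`integral_maxExp_eq_sum`); ties
between positive terms are null since `λ_ij > 0`. Cameron–Martin trades the weight `exp(α_j Z_j)`
for shifts of `Z_i` by `α_j ρ_ij` and of `Y` by `α_j ρ_j0`. What remains is the probability that `Y`
exceeds a level while the normalized differences `(α_i Z_i - α_j Z_j) / λ_ij` stay below bounds.
Regressing `Y` on these differences identifies it as `Φ(α_j ρ_j0 - c)` times an extended skew-normal
distribution function (`measureReal_lt_and_le_eq_esnCdf`), and the prefactor cancels against `K_j`.
-/

noncomputable section

/-! ### Exponential tilting of Gaussian laws -/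

/-- The one-dimensional Cameron–Martin formula for the standard normal law. -/
lemma lintegral_exp_mul_gaussianReal (a : ℝ) (f : ℝ → ENNReal) :
    ∫⁻ x, ENNReal.ofReal (Real.exp (a * x)) * f x ∂(gaussianReal 0 1) =
      ENNReal.ofReal (Real.exp (a ^ 2 / 2)) * ∫⁻ x, f (x + a) ∂(gaussianReal 0 1) := by
  rw [gaussianReal_of_var_ne_zero 0 one_ne_zero,
    lintegral_withDensity_eq_lintegral_mul_non_measurable _ (measurable_gaussianPDF 0 1)
      (ae_of_all _ fun _ => gaussianPDF_lt_top),
    lintegral_withDensity_eq_lintegral_mul_non_measurable _ (measurable_gaussianPDF 0 1)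
      (ae_of_all _ fun _ => gaussianPDF_lt_top),
    ← lintegral_const_mul' _ _ ENNReal.ofReal_ne_top,
    ← lintegral_add_right_eq_self _ a]
  -- With the left side translated by `a`, the densities match through `a (x + a) - (x + a)² / 2 =
  -- a² / 2 - x² / 2`.
  congr with x
  simp only [Pi.mul_apply, ← mul_assoc]
  congr 1
  simp only [gaussianPDF]
  rw [← ENNReal.ofReal_mul (gaussianPDFReal_nonneg _ _ _), ← ENNReal.ofReal_mul (by positivity)]
  congr 1
  simp only [gaussianPDFReal, NNReal.coe_one]
  rw [mul_assoc, ← Real.exp_add, mul_left_comm, ← Real.exp_add]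
  congr 2
  ring

/-- The Cameron–Martin formula for a finite Gaussian family `R` weighted by the exponential of a
jointly Gaussian standard normal variable `G`. -/
lemma lintegral_exp_mul_gaussian {Ω κ : Type*} [Fintype κ] [MeasurableSpace Ω] {P : Measure Ω}
    [IsProbabilityMeasure P] {G : Ω → ℝ} {R : κ → Ω → ℝ}
    (h : HasGaussianLaw (fun ω => (G ω, fun k => R k ω)) P)
    (hG : ∫ ω, G ω ∂P = 0) (hGv : Var[G; P] = 1) (a : ℝ)
    {f : (κ → ℝ) → ENNReal} (hf : Measurable f) :
    ∫⁻ ω, ENNReal.ofReal (Real.exp (a * G ω)) * f (fun k => R k ω) ∂P =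
      ENNReal.ofReal (Real.exp (a ^ 2 / 2)) *
        ∫⁻ ω, f (fun k => R k ω + a * cov[R k, G; P]) ∂P := by
  set v : κ → ℝ := fun k => cov[R k, G; P] with hv
  have hRk : ∀ k, HasGaussianLaw (R k) P := fun k => h.snd.eval k
  have hGl : HasLaw G (gaussianReal 0 1) P :=
    ⟨h.fst.aemeasurable, by rw [h.fst.map_eq_gaussianReal, hG, hGv]; simp⟩
  have hres : HasGaussianLaw (fun ω => ((fun _ : Unit => G ω), fun k => R k ω - v k * G ω)) P := by
    let L : ℝ × (κ → ℝ) →L[ℝ] (Unit → ℝ) × (κ → ℝ) :=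
      (ContinuousLinearMap.pi fun _ => ContinuousLinearMap.fst ℝ ℝ (κ → ℝ)).prod
        (ContinuousLinearMap.pi fun k =>
          (ContinuousLinearMap.proj k).comp (ContinuousLinearMap.snd ℝ ℝ (κ → ℝ)) -
            v k • ContinuousLinearMap.fst ℝ ℝ (κ → ℝ))
    exact h.map_fun L
  -- The regression residual of `R` on `G` is uncorrelated with `G`, hence independent of it by
  -- joint Gaussianity. Tilting then acts on `G` alone.
  have hind : IndepFun G (fun ω k => R k ω - v k * G ω) P := by
    have := HasGaussianLaw.indepFun_of_covariance_eval (X := fun _ : Unit => G)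
      (Y := fun k ω => R k ω - v k * G ω) hres ?_
    · exact this.comp (φ := fun p : Unit → ℝ => p ()) (ψ := id) (by fun_prop) measurable_id
    · intro _ k
      rw [covariance_fun_sub_right h.fst.memLp_two (hRk k).memLp_two
        (h.fst.memLp_two.const_mul (v k)), covariance_const_mul_right, covariance_self
        h.fst.aemeasurable, hGv, covariance_comm]
      simp [hv]
  set N : Ω → κ → ℝ := fun ω k => R k ω - v k * G ω
  have hN : AEMeasurable N P := hres.snd.aemeasurable
  have hlaw : HasLaw (fun ω => (G ω, N ω)) ((gaussianReal 0 1).prod (P.map N)) P :=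
    hind.hasLaw_prod hGl ⟨hN, rfl⟩
  have := Measure.isProbabilityMeasure_map hN
  have hR : ∀ ω, (fun k => R k ω) = fun k => N ω k + v k * G ω := fun ω => by
    ext k; simp [N]
  have hR' : ∀ ω, (fun k => R k ω + a * v k) = fun k => N ω k + v k * (G ω + a) := fun ω => by
    ext k; simp only [N]; ring
  change _ = _ * ∫⁻ ω, f (fun k => R k ω + a * v k) ∂P
  simp only [hR', hR]
  rw [hlaw.lintegral_comp (f := fun p => ENNReal.ofReal (Real.exp (a * p.1)) *
      f (fun k => p.2 k + v k * p.1)) (by fun_prop),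
    hlaw.lintegral_comp (f := fun p => f (fun k => p.2 k + v k * (p.1 + a))) (by fun_prop),
    lintegral_prod_symm _ (by fun_prop), lintegral_prod_symm _ (by fun_prop),
    ← lintegral_const_mul' _ _ ENNReal.ofReal_ne_top]
  congr with y
  exact lintegral_exp_mul_gaussianReal a _

/-! ### Gaussian selection and the extended skew-normal law -/

/-- The map `x ↦ -x / √v` standardizes the law and turns an upper tail into a lower one; the
endpoint has no mass. -/
lemma gaussianReal_Ioi {v : ℝ} (hv : 0 < v) (c : ℝ) :
    gaussianReal 0 v.toNNReal (Set.Ioi c) = ENNReal.ofReal (stdNormalCdf (-c / √v)) := by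
  have hs : 0 < √v := Real.sqrt_pos.2 hv
  have hmap : (gaussianReal 0 v.toNNReal).map (fun x => x * (-1 / √v)) = gaussianReal 0 1 := by
    rw [gaussianReal_map_mul_const]
    congr 1
    · simp
    · ext
      simp only [NNReal.coe_mul, NNReal.coe_mk, Real.coe_toNNReal v hv.le, NNReal.coe_one]
      rw [div_pow, Real.sq_sqrt hv.le]
      field_simp
  have : NullSingletonClass (gaussianReal 0 1) := nullSingletonClass_gaussianReal one_ne_zero
  rw [stdNormalCdf, ofReal_cdf, measure_congr (Iio_ae_eq_Iic (a := -c / √v)).symm, ← hmap,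
    Measure.map_apply (by fun_prop) measurableSet_Iio]
  congr 1
  ext x
  simp only [Set.mem_Ioi, Set.mem_preimage, Set.mem_Iio]
  rw [mul_div_assoc', mul_neg_one, div_lt_div_iff_of_pos_right hs, neg_lt_neg_iff]

lemma stdNormalCdf_pos (x : ℝ) : 0 < stdNormalCdf x := by
  have h : 0 < gaussianReal 0 1 (Set.Iic x) := by
    rw [pos_iff_ne_zero]
    intro h0
    have := gaussianReal_absolutelyContinuous' 0 one_ne_zero h0
    simp at this
  rw [stdNormalCdf, cdf_eq_real]
  exact ENNReal.toReal_pos h.ne' (measure_ne_top _ _)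

/-- A centered Gaussian vector with covariance matrix `S` has the law `N(0, S)`. -/
lemma hasLaw_multivariateGaussian {Ω ι : Type*} [Fintype ι] [DecidableEq ι] [MeasurableSpace Ω]
    {P : Measure Ω} {R : ι → Ω → ℝ} {S : Matrix ι ι ℝ}
    (h : HasGaussianLaw (fun ω i => R i ω) P) (hm : ∀ i, ∫ ω, R i ω ∂P = 0)
    (hS : ∀ i k, cov[R i, R k; P] = S i k) :
    HasLaw (fun ω => WithLp.toLp 2 fun i => R i ω) (multivariateGaussian 0 S) P := by
  have := h.isProbabilityMeasure
  have hL := h.toLp_pi 2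
  have hR : ∀ i, MemLp (R i) 2 P := fun i => (h.eval i).memLp_two
  have hvar : ∀ t : ι → ℝ, Var[fun ω => ∑ i, t i * R i ω; P] = t ⬝ᵥ S *ᵥ t := fun t => by
    rw [← covariance_self (memLp_finsetSum _ fun i _ => (hR i).const_mul (t i)).aemeasurable,
      covariance_fun_sum_fun_sum (fun i => (hR i).const_mul _) (fun i => (hR i).const_mul _)]
    simp only [covariance_const_mul_left, covariance_const_mul_right, hS, dotProduct, mulVec,
      Finset.mul_sum]
    exact Finset.sum_congr rfl fun i _ => Finset.sum_congr rfl fun k _ => by ring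
  -- `multivariateGaussian` has the expected characteristic function only for positive semidefinite
  -- `S`. This comes from the nonnegative variances of linear combinations of the `R i`.
  have hpos : S.PosSemidef := by
    refine Matrix.PosSemidef.of_dotProduct_mulVec_nonneg ?_ fun t => ?_
    · ext i k
      simp [← hS, covariance_comm (R i)]
    · simpa [hvar] using variance_nonneg (fun ω => ∑ i, t i * R i ω) P
  have hgl : HasGaussianLaw (fun ω => WithLp.toLp 2 fun i => R i ω) P := hL
  refine ⟨hgl.aemeasurable, ?_⟩
  have := Measure.isProbabilityMeasure_map hgl.aemeasurable
  refine Measure.ext_of_charFun (funext fun t => ?_)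
  rw [hgl.charFun_map_eq, charFun_multivariateGaussian hpos]
  have e : (fun ω => inner ℝ t (WithLp.toLp 2 fun i => R i ω)) = fun ω => ∑ i, t i * R i ω := by
    ext ω
    simp [PiLp.inner_apply, mul_comm]
  rw [e, hvar, integral_finsetSum _ fun i _ => ((h.eval i).integrable.const_mul _)]
  simp [integral_const_mul, hm]

/-- Selecting on a jointly Gaussian variable produces the extended skew-normal law. -/
lemma measureReal_lt_and_le_eq_esnCdf {Ω ι : Type*} [Fintype ι] [DecidableEq ι]
    [MeasurableSpace Ω] {P : Measure Ω} {R : ι → Ω → ℝ} {Y : Ω → ℝ} {S : Matrix ι ι ℝ}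
    {δ : ι → ℝ} (h : HasGaussianLaw (fun ω => (Y ω, fun i => R i ω)) P)
    (hm : ∀ i, ∫ ω, R i ω ∂P = 0) (hmY : ∫ ω, Y ω ∂P = 0)
    (hS : ∀ i k, cov[R i, R k; P] = S i k) (hdiag : ∀ i, S i i = 1) (hdet : IsUnit S.det)
    (hδ : ∀ i, cov[R i, Y; P] = δ i) (hY : Var[Y; P] = 1) (hq : δ ⬝ᵥ (S⁻¹ *ᵥ δ) < 1)
    (s : ℝ) (q : ι → EReal) :
    P.real {ω | s < Y ω ∧ ∀ i, (R i ω : EReal) ≤ q i} =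
      stdNormalCdf (-s) * esnCdf S ((1 / √(1 - δ ⬝ᵥ (S⁻¹ *ᵥ δ))) • (S⁻¹ *ᵥ δ))
        (-s / √(1 - δ ⬝ᵥ (S⁻¹ *ᵥ δ))) q := by
  have := h.isProbabilityMeasure
  set w := S⁻¹ *ᵥ δ with hw
  set Q := δ ⬝ᵥ w with hQ
  have hv : 0 < 1 - Q := sub_pos.2 hq
  have hσ : 0 < √(1 - Q) := Real.sqrt_pos.2 hv
  have hSw : S *ᵥ w = δ := by
    rw [hw, mulVec_mulVec, Matrix.mul_nonsing_inv S hdet, one_mulVec]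
  have hR : ∀ i, MemLp (R i) 2 P := fun i => (h.snd.eval i).memLp_two
  have hY2 : MemLp Y 2 P := h.fst.memLp_two
  have hsum : MemLp (fun ω => ∑ i, w i * R i ω) 2 P :=
    memLp_finsetSum _ fun i _ => (hR i).const_mul _
  -- `w` is the vector of regression coefficients of `Y` on `R`. The residual is independent of `R`
  -- and has variance `1 - Q`.
  set N : Ω → ℝ := fun ω => Y ω - ∑ i, w i * R i ω with hN
  have hNcov : ∀ k, cov[N, R k; P] = 0 := fun k => by
    rw [hN, covariance_fun_sub_left hY2 hsum (hR k),
      covariance_fun_sum_left (fun i => (hR i).const_mul _) (hR k), covariance_comm, hδ, ← hSw]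
    simp only [covariance_const_mul_left, mulVec, dotProduct, ← hS]
    rw [sub_eq_zero]
    exact Finset.sum_congr rfl fun i _ => by rw [covariance_comm, mul_comm]
  have hN2 : MemLp N 2 P := hY2.sub hsum
  have hNvar : Var[N; P] = 1 - Q := by
    rw [← covariance_self hN2.aemeasurable]
    conv_lhs => rw [show cov[N, N; P] = cov[N, fun ω => Y ω - ∑ i, w i * R i ω; P] from rfl]
    rw [covariance_fun_sub_right hN2 hY2 hsum,
      covariance_fun_sum_right (fun i => (hR i).const_mul _) hN2]
    simp only [covariance_const_mul_right, hNcov, mul_zero, Finset.sum_const_zero, sub_zero]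
    rw [hN, covariance_fun_sub_left hY2 hsum hY2, covariance_self hY2.aemeasurable, hY,
      covariance_fun_sum_left (fun i => (hR i).const_mul _) hY2]
    simp only [covariance_const_mul_left, hδ, hQ, dotProduct]
    simp only [mul_comm]
  have hjoint : HasGaussianLaw (fun ω => ((fun _ : Unit => N ω), fun i => R i ω)) P := by
    let L : ℝ × (ι → ℝ) →L[ℝ] (Unit → ℝ) × (ι → ℝ) :=
      (ContinuousLinearMap.pi fun _ => ContinuousLinearMap.fst ℝ ℝ (ι → ℝ) -
          ∑ i, w i • (ContinuousLinearMap.proj i).comp (ContinuousLinearMap.snd ℝ ℝ (ι → ℝ))).prod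
        (ContinuousLinearMap.snd ℝ ℝ (ι → ℝ))
    convert! h.map_fun L using 1
    ext ω : 1
    simp [L, hN]
  have hNlaw : HasLaw N (gaussianReal 0 (1 - Q).toNNReal) P := by
    have hg : HasGaussianLaw N P := hjoint.fst.eval ()
    refine ⟨hg.aemeasurable, ?_⟩
    rw [hg.map_eq_gaussianReal, hNvar]
    congr 1
    rw [hN, integral_sub h.fst.integrable (hsum.integrable (by norm_num)), hmY,
      integral_finsetSum _ fun i _ => ((h.snd.eval i).integrable.const_mul _)]
    simp [integral_const_mul, hm]
  have hind : IndepFun N (fun ω => WithLp.toLp 2 fun i => R i ω) P :=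
    (HasGaussianLaw.indepFun_of_covariance_eval (X := fun _ : Unit => N) (Y := R) hjoint
      fun _ k => hNcov k).comp (φ := fun p : Unit → ℝ => p ()) (ψ := WithLp.toLp 2)
      (by fun_prop) (by fun_prop)
  have hlaw := hind.hasLaw_prod hNlaw (hasLaw_multivariateGaussian h.snd hm hS)
  have hA : MeasurableSet {y : EuclideanSpace ℝ ι | ∀ i, (y i : EReal) ≤ q i} := by
    rw [Set.ofPred_forall]
    refine MeasurableSet.iInter fun i => measurableSet_le ?_ measurable_const
    exact measurable_coe_real_ereal.comp (by fun_prop)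
  have hmeas : MeasurableSet {p : ℝ × EuclideanSpace ℝ ι |
      s < p.1 + w ⬝ᵥ p.2 ∧ ∀ i, (p.2 i : EReal) ≤ q i} := by
    rw [Set.ofPred_and]
    refine MeasurableSet.inter (measurableSet_lt measurable_const ?_) (measurable_snd hA)
    simp only [dotProduct]
    fun_prop
  have hset : {ω | s < Y ω ∧ ∀ i, (R i ω : EReal) ≤ q i} =
      {ω | s < N ω + w ⬝ᵥ (fun i => R i ω) ∧ ∀ i, (R i ω : EReal) ≤ q i} := by
    ext ω
    simp [hN, dotProduct]
  have hcorr : correlationMatrix S = S := by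
    ext i k
    simp [correlationMatrix, hdiag]
  -- The normalizing constant of the skew-normal density collapses to `Φ(-s)`, since `1 + aᵀ S a = 1
  -- + Q / (1 - Q) = 1 / (1 - Q)` for `a = w / √(1 - Q)`.
  have hnorm : -s / √(1 - Q) / √(1 + ((1 / √(1 - Q)) • w) ⬝ᵥ (S *ᵥ ((1 / √(1 - Q)) • w))) = -s := by
    have e : 1 + ((1 / √(1 - Q)) • w) ⬝ᵥ (S *ᵥ ((1 / √(1 - Q)) • w)) = (1 - Q)⁻¹ := by
      rw [mulVec_smul, hSw, smul_dotProduct, dotProduct_smul, dotProduct_comm, ← hQ, smul_eq_mul,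
        smul_eq_mul, ← mul_assoc, div_mul_div_comm, Real.mul_self_sqrt hv.le]
      field_simp
      ring
    rw [e, Real.sqrt_inv]
    field_simp
  have hΦ := stdNormalCdf_pos (-s)
  have key : P {ω | s < Y ω ∧ ∀ i, (R i ω : EReal) ≤ q i} =
      ENNReal.ofReal (stdNormalCdf (-s)) * esnMeasure S ((1 / √(1 - Q)) • w) (-s / √(1 - Q))
        {y | ∀ i, (y i : EReal) ≤ q i} := by
    rw [hset]
    refine (hlaw.measure_eq (p := fun p => s < p.1 + w ⬝ᵥ p.2 ∧ ∀ i, (p.2 i : EReal) ≤ q i)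
      hmeas).trans ?_
    -- Integrating out the residual with `R = y` fixed leaves `P(N > s - w · y) = Φ((w · y - s) /
    -- √(1 - Q))`, the skewing factor of the density.
    rw [Measure.prod_apply_symm hmeas, esnMeasure, withDensity_apply _ hA,
      ← lintegral_const_mul' _ _ ENNReal.ofReal_ne_top, ← lintegral_indicator hA]
    congr with y
    by_cases hy : ∀ i, (y i : EReal) ≤ q i
    · rw [Set.indicator_of_mem (by exact hy), ← ENNReal.ofReal_mul hΦ.le, hcorr, hnorm,
        mul_div_cancel₀ _ hΦ.ne']
      have : (fun x : ℝ => (x, y)) ⁻¹' {p | s < p.1 + w ⬝ᵥ p.2 ∧ ∀ i, (p.2 i : EReal) ≤ q i} =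
          Set.Ioi (s - w ⬝ᵥ y) := by
        ext x
        simp [hy, sub_lt_iff_lt_add]
      rw [this, gaussianReal_Ioi hv]
      congr 2
      simp only [hdiag, Real.sqrt_one, div_one, smul_dotProduct, smul_eq_mul]
      ring
    · rw [Set.indicator_of_notMem (by exact hy)]
      simp [hy]
  rw [measureReal_def, key, ENNReal.toReal_mul, ENNReal.toReal_ofReal hΦ.le]
  rfl

/-! ### Tails of the model, conditionally on its Gaussian part -/

/-- This is the uniformity of `exp(-V)` on the unit interval; the minimum covers thresholds above 1.
-/
lemma expMeasure_exp_neg_lt {m : ℝ} (hm : 0 ≤ m) :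
    expMeasure 1 {v | Real.exp (-v) < m} = ENNReal.ofReal (min 1 m) := by
  have := isProbabilityMeasure_expMeasure one_pos
  rcases hm.eq_or_lt with rfl | hm
  · have : {v : ℝ | Real.exp (-v) < 0} = ∅ := by
      ext v
      simpa using (Real.exp_pos _).le
    simp [this]
  have hset : {v | Real.exp (-v) < m} = (Set.Iic (-Real.log m))ᶜ := by
    ext v
    simp only [Set.mem_ofPred_eq, Set.mem_compl_iff, Set.mem_Iic, not_le]
    rw [← Real.lt_log_iff_exp_lt hm, neg_lt]
  rw [hset, prob_compl_eq_one_sub measurableSet_Iic, ← ofReal_cdf,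
    ← ENNReal.ofReal_one, ← ENNReal.ofReal_sub _ (cdf_nonneg _ _), cdf_expMeasure_eq one_pos]
  congr 1
  split_ifs with h
  · rw [one_mul, neg_neg, Real.exp_log hm, sub_sub_cancel, min_eq_right]
    rw [← Real.exp_log hm, Real.exp_le_one_iff]
    linarith
  · rw [min_eq_left, sub_zero]
    rw [← Real.exp_log hm, Real.one_le_exp_iff]
    linarith

/-- `max_i β_i exp(α_i z_i)`. -/
def maxExp {κ : Type*} [Fintype κ] [Nonempty κ] (α β z : κ → ℝ) : ℝ :=
  Finset.univ.sup' Finset.univ_nonempty fun i => β i * Real.exp (α i * z i)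

section maxExp

variable {κ : Type*} [Fintype κ] [Nonempty κ] {α β : κ → ℝ}

lemma le_maxExp (α β z : κ → ℝ) (i : κ) : β i * Real.exp (α i * z i) ≤ maxExp α β z :=
  Finset.le_sup' (fun i => β i * Real.exp (α i * z i)) (Finset.mem_univ i)

lemma maxExp_nonneg (hβ : ∀ i, 0 ≤ β i) (z : κ → ℝ) : 0 ≤ maxExp α β z :=
  (mul_nonneg (hβ (Classical.arbitrary κ)) (Real.exp_pos _).le).trans (le_maxExp α β z _)

lemma maxExp_le_sum (hβ : ∀ i, 0 ≤ β i) (z : κ → ℝ) :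
    maxExp α β z ≤ ∑ i, β i * Real.exp (α i * z i) :=
  Finset.sup'_le _ _ fun i _ => Finset.single_le_sum
    (f := fun i => β i * Real.exp (α i * z i))
    (fun k _ => mul_nonneg (hβ k) (Real.exp_pos _).le) (Finset.mem_univ i)

lemma mul_maxExp {r : ℝ} (hr : 0 ≤ r) (α β z : κ → ℝ) :
    r * maxExp α β z = maxExp α (fun i => r * β i) z := by
  simp [maxExp, Finset.mul₀_sup' hr, mul_assoc]

@[fun_prop]
lemma measurable_maxExp (α β : κ → ℝ) : Measurable (maxExp α β) := by
  unfold maxExp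
  have := Finset.measurable_sup' (f := fun i (z : κ → ℝ) => β i * Real.exp (α i * z i))
    (Finset.univ_nonempty (α := κ)) fun i _ => by fun_prop
  convert! this using 1
  ext z
  simp [Finset.sup'_apply]

lemma tendsto_maxExp {N : Type*} {l : Filter N} {b : N → κ → ℝ}
    (hb : ∀ i, Tendsto (fun n => b n i) l (𝓝 (β i))) (z : κ → ℝ) :
    Tendsto (fun n => maxExp α (b n) z) l (𝓝 (maxExp α β z)) :=
  Tendsto.finset_sup'_nhds_apply _ fun i _ => (hb i).mul_const _

end maxExp

/-- The conditional probability, given `(z, y)`, that some `exp(-α_i X_i)` is less than `b_i`. -/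
def exceedance {κ : Type*} [Fintype κ] [Nonempty κ] (α : κ → ℝ) (c : ℝ) (b z : κ → ℝ) (y : ℝ) :
    ℝ :=
  open Classical in
  if c < y then min 1 (maxExp α b z) else if ∃ i, Real.exp (-(α i * z i)) < b i then 1 else 0

section exceedance

variable {κ : Type*} [Fintype κ] [Nonempty κ] {α b : κ → ℝ} {c : ℝ}

lemma exceedance_nonneg (hb : ∀ i, 0 ≤ b i) (z : κ → ℝ) (y : ℝ) : 0 ≤ exceedance α c b z y := by
  unfold exceedance
  split_ifs
  · exact le_min zero_le_one (maxExp_nonneg hb z)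
  · exact zero_le_one
  · exact le_rfl

/-- A bound linear in `b` and uniform over both branches: without the factor, an exceedance means `1
< b i * exp(α i * z i)` for some `i`. It supplies the integrable majorant for dominated convergence.
-/
lemma exceedance_le_sum (hb : ∀ i, 0 ≤ b i) (z : κ → ℝ) (y : ℝ) :
    exceedance α c b z y ≤ ∑ i, b i * Real.exp (α i * z i) := by
  unfold exceedance
  split_ifs with h h'
  · exact (min_le_right _ _).trans (maxExp_le_sum hb z)
  · obtain ⟨i, hi⟩ := h'
    refine le_trans ?_ ((le_maxExp α b z i).trans (maxExp_le_sum hb z))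
    rw [Real.exp_neg, inv_lt_iff_one_lt_mul₀ (Real.exp_pos _)] at hi
    linarith
  · exact (maxExp_nonneg hb z).trans (maxExp_le_sum hb z)

lemma measurable_exceedance (α : κ → ℝ) (c : ℝ) (b : κ → ℝ) :
    Measurable fun p : (κ → ℝ) × ℝ => exceedance α c b p.1 p.2 := by
  unfold exceedance
  refine Measurable.ite (measurableSet_lt measurable_const measurable_snd) (by fun_prop)
    (Measurable.ite ?_ measurable_const measurable_const)
  rw [Set.ofPred_exists]
  exact MeasurableSet.iUnion fun i => measurableSet_lt (by fun_prop) measurable_const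

/-- Because `α i * (v / α i) = v`, all coordinates compare the same `exp(-v)` with `b i * exp(α i *
z i)`, so the union over `i` is a single event about the maximum. -/
lemma expMeasure_exceedance (hα : ∀ i, 0 < α i) (hb : ∀ i, 0 ≤ b i) (z : κ → ℝ) (y : ℝ) :
    expMeasure 1 {v | ∃ i, Real.exp (-(α i * (z i + if c < y then v / α i else 0))) < b i} =
      ENNReal.ofReal (exceedance α c b z y) := by
  have := isProbabilityMeasure_expMeasure one_pos
  unfold exceedance
  split_ifs with h h'
  · rw [← expMeasure_exp_neg_lt (maxExp_nonneg hb z)]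
    congr with v
    rw [maxExp, Finset.lt_sup'_iff]
    simp only [Finset.mem_univ, true_and]
    refine exists_congr fun i => ?_
    rw [mul_add, mul_div_cancel₀ _ (hα i).ne', neg_add, Real.exp_add, Real.exp_neg (α i * z i),
      inv_mul_lt_iff₀ (Real.exp_pos _), mul_comm (b i)]
  · simp [h']
  · simp [h']

/-- The tail of the common-factor model, by conditioning on the Gaussian part. -/
lemma measureReal_exists_exp_lt {Ω : Type*} [MeasurableSpace Ω] {P : Measure Ω}
    [IsProbabilityMeasure P] {Z X : κ → Ω → ℝ} {Y V : Ω → ℝ} (hα : ∀ i, 0 < α i)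
    (hV : HasLaw V (expMeasure 1) P) (hZY : AEMeasurable (fun ω => ((fun i => Z i ω), Y ω)) P)
    (hind : IndepFun V (fun ω => ((fun i => Z i ω), Y ω)) P)
    (hX : ∀ i, ∀ᵐ ω ∂P, X i ω = Z i ω + if c < Y ω then V ω / α i else 0)
    (hb : ∀ i, 0 ≤ b i) :
    P.real {ω | ∃ i, Real.exp (-(α i * X i ω)) < b i} =
      ∫ ω, exceedance α c b (fun i => Z i ω) (Y ω) ∂P := by
  have := isProbabilityMeasure_expMeasure one_pos
  set T : Ω → (κ → ℝ) × ℝ := fun ω => ((fun i => Z i ω), Y ω) with hT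
  have := Measure.isProbabilityMeasure_map hZY
  have hlaw := hind.hasLaw_prod hV ⟨hZY, rfl⟩
  have hmeas : MeasurableSet {p : ℝ × ((κ → ℝ) × ℝ) |
      ∃ i, Real.exp (-(α i * (p.2.1 i + if c < p.2.2 then p.1 / α i else 0))) < b i} := by
    rw [Set.ofPred_exists]
    refine MeasurableSet.iUnion fun i => measurableSet_lt ?_ measurable_const
    have : Measurable fun p : ℝ × ((κ → ℝ) × ℝ) => if c < p.2.2 then p.1 / α i else 0 :=
      Measurable.ite (measurableSet_lt measurable_const (by fun_prop)) (by fun_prop)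
        measurable_const
    fun_prop
  have hcongr : P {ω | ∃ i, Real.exp (-(α i * X i ω)) < b i} =
      P {ω | ∃ i, Real.exp (-(α i * (Z i ω + if c < Y ω then V ω / α i else 0))) < b i} := by
    refine measure_congr ?_
    filter_upwards [ae_all_iff.2 hX] with ω hω
    simp only [eq_iff_iff]
    change (∃ i, _) ↔ ∃ i, _
    simp only [hω]
  rw [integral_eq_lintegral_of_nonneg_ae (ae_of_all _ fun ω => exceedance_nonneg hb _ _)
    ((measurable_exceedance α c b).comp_aemeasurable hZY).aestronglyMeasurable,
    measureReal_def, hcongr]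
  congr 1
  refine (hlaw.measure_eq (p := fun p => ∃ i, Real.exp (-(α i * (p.2.1 i +
    if c < p.2.2 then p.1 / α i else 0))) < b i) hmeas).trans ?_
  rw [Measure.prod_apply_symm hmeas, ← lintegral_map' (f := fun p : (κ → ℝ) × ℝ =>
    ENNReal.ofReal (exceedance α c b p.1 p.2))
    (measurable_exceedance α c b).ennreal_ofReal.aemeasurable hZY]
  exact lintegral_congr fun p => expMeasure_exceedance hα hb p.1 p.2

/-- As `r → ∞` with `r * bs` convergent, the thresholds tend to 0. Pointwise, the cap at 1 is then
eventually inactive and the branch without the factor eventually vanishes. -/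
lemma tendsto_mul_exceedance {N : Type*} {l : Filter N} {r : N → ℝ} {bs : N → κ → ℝ} {β : κ → ℝ}
    (hr : Tendsto r l atTop) (hb : ∀ i, Tendsto (fun n => r n * bs n i) l (𝓝 (β i)))
    (z : κ → ℝ) (y : ℝ) :
    Tendsto (fun n => r n * exceedance α c (bs n) z y) l
      (𝓝 (if c < y then maxExp α β z else 0)) := by
  have hdiv : ∀ {u : N → ℝ} {a : ℝ}, Tendsto (fun n => r n * u n) l (𝓝 a) →
      Tendsto u l (𝓝 0) := fun {u a} hu => by
    refine (hu.div_atTop hr).congr' ?_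
    filter_upwards [hr.eventually_gt_atTop 0] with n hn
    exact mul_div_cancel_left₀ _ hn.ne'
  unfold exceedance
  split_ifs with h
  · have h1 : Tendsto (fun n => r n * maxExp α (bs n) z) l (𝓝 (maxExp α β z)) := by
      refine (tendsto_maxExp hb z).congr' ?_
      filter_upwards [hr.eventually_ge_atTop 0] with n hn
      rw [mul_maxExp hn]
    refine h1.congr' ?_
    filter_upwards [(hdiv h1).eventually_le_const zero_lt_one] with n hn
    rw [min_eq_right hn]
  · refine tendsto_const_nhds.congr' ?_
    have h0 : ∀ᶠ n in l, ∀ i, bs n i ≤ Real.exp (-(α i * z i)) :=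
      eventually_all.2 fun i => (hdiv (hb i)).eventually_le_const (Real.exp_pos _)
    filter_upwards [h0] with n hn
    rw [if_neg (by push Not; exact hn), mul_zero]

/-- Rescaled joint tail probabilities of the common-factor model converge. -/
lemma tendsto_mul_measureReal_exists_exp_lt {Ω : Type*} [MeasurableSpace Ω] {P : Measure Ω}
    [IsProbabilityMeasure P] {Z X : κ → Ω → ℝ} {Y V : Ω → ℝ} (hα : ∀ i, 0 < α i)
    (hV : HasLaw V (expMeasure 1) P) (hZY : AEMeasurable (fun ω => ((fun i => Z i ω), Y ω)) P)
    (hind : IndepFun V (fun ω => ((fun i => Z i ω), Y ω)) P)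
    (hX : ∀ i, ∀ᵐ ω ∂P, X i ω = Z i ω + if c < Y ω then V ω / α i else 0)
    (hint : ∀ i, Integrable (fun ω => Real.exp (α i * Z i ω)) P)
    {N : Type*} {l : Filter N} [l.IsCountablyGenerated] {r : N → ℝ} {bs : N → κ → ℝ} {β : κ → ℝ}
    (hr : Tendsto r l atTop) (hb0 : ∀ᶠ n in l, ∀ i, 0 ≤ bs n i)
    (hb : ∀ i, Tendsto (fun n => r n * bs n i) l (𝓝 (β i))) :
    Tendsto (fun n => r n * P.real {ω | ∃ i, Real.exp (-(α i * X i ω)) < bs n i}) l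
      (𝓝 (∫ ω, if c < Y ω then maxExp α β (fun i => Z i ω) else 0 ∂P)) := by
  have hlim : Tendsto (fun n => ∫ ω, r n * exceedance α c (bs n) (fun i => Z i ω) (Y ω) ∂P) l
      (𝓝 (∫ ω, if c < Y ω then maxExp α β (fun i => Z i ω) else 0 ∂P)) := by
    refine tendsto_integral_filter_of_dominated_convergence
      (fun ω => ∑ i, (β i + 1) * Real.exp (α i * Z i ω)) ?_ ?_ ?_ ?_
    · exact Eventually.of_forall fun n => (((measurable_exceedance α c (bs n)).comp_aemeasurable
        hZY).const_mul _).aestronglyMeasurable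
    · have hle : ∀ᶠ n in l, ∀ i, r n * bs n i ≤ β i + 1 :=
        eventually_all.2 fun i => (hb i).eventually_le_const (lt_add_one _)
      filter_upwards [hb0, hle, hr.eventually_ge_atTop 0] with n h0 hn hrn
      refine ae_of_all _ fun ω => ?_
      rw [Real.norm_of_nonneg (mul_nonneg hrn (exceedance_nonneg h0 _ _))]
      refine (mul_le_mul_of_nonneg_left (exceedance_le_sum h0 _ _) hrn).trans ?_
      rw [Finset.mul_sum]
      refine Finset.sum_le_sum fun i _ => ?_
      rw [← mul_assoc]
      exact mul_le_mul_of_nonneg_right (hn i) (Real.exp_pos _).le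
    · exact integrable_finsetSum _ fun i _ => (hint i).const_mul _
    · exact ae_of_all _ fun ω => tendsto_mul_exceedance hr hb _ _
  refine hlim.congr' ?_
  filter_upwards [hb0] with n h0
  rw [integral_const_mul, measureReal_exists_exp_lt hα hV hZY hind hX h0]

end exceedance

/-! ### Quantiles of atomless laws -/

section quantile

variable {μ : Measure ℝ}

lemma continuous_cdf [IsProbabilityMeasure μ] [NullSingletonClass μ] : Continuous (cdf μ) := by
  refine continuous_iff_continuousAt.2 fun a => ?_
  rw [(monotone_cdf μ).continuousAt_iff_leftLim_eq_rightLim, StieltjesFunction.rightLim_eq]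
  have h := StieltjesFunction.measure_singleton (cdf μ) a
  rw [measure_cdf, measure_singleton, eq_comm, ENNReal.ofReal_eq_zero, sub_nonpos] at h
  exact le_antisymm ((monotone_cdf μ).leftLim_le le_rfl) h

lemma isLeast_sInf_le_cdf [IsProbabilityMeasure μ] [NullSingletonClass μ] {u : ℝ} (hu : 0 < u)
    (hne : {x | u ≤ cdf μ x}.Nonempty) :
    IsLeast {x | u ≤ cdf μ x} (sInf {x | u ≤ cdf μ x}) := by
  have hbdd : BddBelow {x | u ≤ cdf μ x} := by
    obtain ⟨a, ha⟩ := ((tendsto_cdf_atBot μ).eventually_lt_const hu).exists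
    refine ⟨a, fun x (hx : u ≤ cdf μ x) => le_of_lt ?_⟩
    exact (monotone_cdf μ).reflect_lt (ha.trans_le hx)
  have hcl : IsClosed {x | u ≤ cdf μ x} := isClosed_le continuous_const continuous_cdf
  exact ⟨hcl.csInf_mem hne hbdd, fun x hx => csInf_le hbdd hx⟩

lemma quantile_eq_of_isLeast {F : ℝ → ℝ} {u t : ℝ} (h : IsLeast {x | u ≤ F x} t) :
    quantile F u = t := by
  have : IsLeast ((fun x : ℝ => (x : EReal)) '' {x : ℝ | u ≤ F x}) (t : EReal) :=
    ⟨⟨t, h.1, rfl⟩, by rintro _ ⟨x, hx, rfl⟩; exact EReal.coe_le_coe_iff.2 (h.2 hx)⟩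
  exact this.isGLB.sInf_eq

lemma exists_quantile_eq [IsProbabilityMeasure μ] [NullSingletonClass μ] {u : ℝ} (hu : 0 < u)
    (hu1 : u < 1) : ∃ t : ℝ, quantile (cdf μ) u = t ∧ cdf μ t = u := by
  obtain ⟨a, ha⟩ := ((tendsto_cdf_atBot μ).eventually_lt_const hu).exists
  obtain ⟨b, hb⟩ := ((tendsto_cdf_atTop μ).eventually_const_lt hu1).exists
  obtain ⟨t₀, ht₀⟩ := mem_range_of_exists_le_of_exists_ge (continuous_cdf (μ := μ))
    ⟨a, ha.le⟩ ⟨b, hb.le⟩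
  have h := isLeast_sInf_le_cdf (μ := μ) hu ⟨b, hb.le⟩
  refine ⟨_, quantile_eq_of_isLeast h, le_antisymm ?_ h.1⟩
  exact (monotone_cdf μ (h.2 ht₀.ge)).trans ht₀.le

/-- A coordinate with `x i = 0` puts level 1 into the copula; this makes its constraint vacuous
almost surely, whether the quantile is finite or `+∞`. -/
lemma measure_quantile_one_lt [IsProbabilityMeasure μ] [NullSingletonClass μ] :
    μ {x | quantile (cdf μ) 1 < x} = 0 := by
  rcases {x | 1 ≤ cdf μ x}.eq_empty_or_nonempty with h | h
  · simp [quantile, h]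
  · have hl := isLeast_sInf_le_cdf one_pos h
    have hle : 1 ≤ cdf μ (sInf {x | 1 ≤ cdf μ x}) := hl.1
    rw [quantile_eq_of_isLeast hl]
    have : {x : ℝ | ((sInf {x | 1 ≤ cdf μ x} : ℝ) : EReal) < x} =
        (Set.Iic (sInf {x | 1 ≤ cdf μ x}))ᶜ := by
      ext x
      simp
    rw [this, prob_compl_eq_one_sub measurableSet_Iic, ← ofReal_cdf]
    rwa [tsub_eq_zero_iff_le, ENNReal.one_le_ofReal]

end quantile

/-! ### From tail asymptotics to the copula -/

/-- If `P(exp(-α X) < b) ~ K b` as `b → 0`, then the levels exceeded with probability `x / n` are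
asymptotic to `x / (K n)`. -/
lemma tendsto_mul_exp_neg_of_tail {Ω : Type*} [MeasurableSpace Ω] {P : Measure Ω}
    [IsProbabilityMeasure P] {W : Ω → ℝ} {K x : ℝ} (hK : 0 < K)
    (htail : Tendsto (fun b => b⁻¹ * P.real {ω | W ω < b}) (𝓝[>] 0) (𝓝 K))
    {b : ℕ → ℝ} (hb0 : ∀ n, 0 < b n)
    (hb : ∀ᶠ n : ℕ in atTop, n * P.real {ω | W ω < b n} = x) :
    Tendsto (fun n : ℕ => n * b n) atTop (𝓝 (x / K)) := by
  have hmono : ∀ {s t}, s ≤ t → P.real {ω | W ω < s} ≤ P.real {ω | W ω < t} := fun h =>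
    measureReal_mono fun ω (hω : _ < _) => hω.trans_le h
  have hpos : ∀ ε > 0, 0 < P.real {ω | W ω < ε} := fun ε hε => by
    have h1 : ∀ᶠ s in 𝓝[>] (0 : ℝ), s ∈ Set.Ioo 0 ε := Ioo_mem_nhdsGT hε
    obtain ⟨s, hs, hsε⟩ := ((htail.eventually_const_lt hK).and h1).exists
    exact (pos_of_mul_pos_right hs (inv_nonneg.2 hsε.1.le)).trans_le (hmono hsε.2.le)
  have hp0 : Tendsto (fun n => P.real {ω | W ω < b n}) atTop (𝓝 0) := by
    refine (tendsto_const_div_atTop_nhds_zero_nat x).congr' ?_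
    filter_upwards [hb, eventually_gt_atTop 0] with n hn h0
    rw [← hn, mul_div_cancel_left₀]
    exact_mod_cast h0.ne'
  -- If `b n` stayed above some `a > 0`, the probabilities would stay above `P(W < a) > 0`, while
  -- they tend to 0.
  have hb_zero : Tendsto b atTop (𝓝[>] 0) := by
    refine tendsto_nhdsWithin_iff.2 ⟨?_, Eventually.of_forall hb0⟩
    refine (tendsto_order.2 ⟨fun a ha => Eventually.of_forall fun n => ha.trans (hb0 n),
      fun a ha => ?_⟩)
    filter_upwards [hp0.eventually_lt_const (hpos a ha)] with n hn
    by_contra! h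
    exact (hmono h).not_gt hn
  -- Dividing `x = n * P(W < b n)` by `(b n)⁻¹ * P(W < b n)` leaves `n * b n`.
  have h2 := (tendsto_const_nhds (x := x)).div (htail.comp hb_zero) hK.ne'
  refine h2.congr' ?_
  filter_upwards [hb] with n hn
  have := (hpos _ (hb0 n)).ne'
  have := (hb0 n).ne'
  simp only [Function.comp_apply, Pi.div_apply]
  rw [← hn]
  field_simp

lemma maxExp_unit (a b z : ℝ) :
    maxExp (fun _ : Unit => a) (fun _ => b) (fun _ => z) = b * Real.exp (a * z) := by
  simp [maxExp]

/-- The common-factor model has continuous margins. -/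
lemma measure_eq_zero_of_factor {Ω : Type*} [MeasurableSpace Ω] {P : Measure Ω}
    [IsProbabilityMeasure P] {Z X Y V : Ω → ℝ} {α c : ℝ} (hα : 0 < α)
    (hV : HasLaw V (expMeasure 1) P) (hZ : AEMeasurable Z P) (hind : IndepFun V Z P)
    (hX : ∀ᵐ ω ∂P, X ω = Z ω + if c < Y ω then V ω / α else 0)
    (hZ0 : ∀ t, P {ω | Z ω = t} = 0) (t : ℝ) : P {ω | X ω = t} = 0 := by
  have hνp := isProbabilityMeasure_expMeasure one_pos
  have hν : NullSingletonClass (expMeasure 1) :=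
    ⟨fun x => (withDensity_absolutelyContinuous _ _) (measure_singleton x)⟩
  -- By Fubini: for fixed `Z` this is a single value of the atomless, independent `V`.
  have h1 : P {ω | V ω = α * (t - Z ω)} = 0 := by
    have hm : MeasurableSet {p : ℝ × ℝ | p.1 = α * (t - p.2)} :=
      measurableSet_eq_fun (by fun_prop) (by fun_prop)
    have := Measure.isProbabilityMeasure_map hZ
    refine ((hind.hasLaw_prod hV ⟨hZ, rfl⟩).measure_eq hm).trans ?_
    rw [Measure.prod_apply_symm hm]
    refine (lintegral_congr fun z => ?_).trans lintegral_zero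
    exact measure_singleton (α * (t - z))
  refine measure_mono_null_ae ?_ (measure_union_null (hZ0 t) h1)
  filter_upwards [hX] with ω hω
  change X ω = t → (Z ω = t ∨ V ω = α * (t - Z ω))
  rw [hω]
  split_ifs
  · intro h
    right
    rw [← h]
    field_simp
    ring
  · intro h
    left
    simpa using h

/-- The stable tail dependence function of the common-factor model as an expectation. -/
lemma tendsto_mul_one_sub_copula {Ω : Type*} [MeasurableSpace Ω] {P : Measure Ω}
    [IsProbabilityMeasure P] {d : ℕ} [Nonempty (Fin d)] {Z X : Fin d → Ω → ℝ} {Y V : Ω → ℝ}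
    {α K : Fin d → ℝ} {c : ℝ} (hα : ∀ i, 0 < α i)
    (hV : HasLaw V (expMeasure 1) P) (hZY : AEMeasurable (fun ω => ((fun i => Z i ω), Y ω)) P)
    (hind : IndepFun V (fun ω => ((fun i => Z i ω), Y ω)) P)
    (hX : ∀ i, ∀ᵐ ω ∂P, X i ω = Z i ω + if c < Y ω then V ω / α i else 0)
    (hint : ∀ i, Integrable (fun ω => Real.exp (α i * Z i ω)) P)
    (hZ0 : ∀ i t, P {ω | Z i ω = t} = 0)
    (hK : ∀ i, ∫ ω, (if c < Y ω then Real.exp (α i * Z i ω) else 0) ∂P = K i)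
    (hKpos : ∀ i, 0 < K i) {x : Fin d → ℝ} (hx : ∀ i, 0 ≤ x i) :
    Tendsto (fun n : ℕ => (n : ℝ) * (1 - copula P X (fun i => 1 - x i / (n : ℝ)))) atTop
      (𝓝 (∫ ω, if c < Y ω then maxExp α (fun i => x i / K i) (fun i => Z i ω) else 0 ∂P)) := by
  have hZm : ∀ i, AEMeasurable (Z i) P := fun i =>
    (show Measurable fun p : (Fin d → ℝ) × ℝ => p.1 i by fun_prop).comp_aemeasurable hZY
  have hYm : AEMeasurable Y P := measurable_snd.comp_aemeasurable hZY
  have hXm : ∀ i, AEMeasurable (X i) P := fun i => by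
    have hm : Measurable fun p : (ℝ × ℝ) × ℝ => p.1.1 + if c < p.1.2 then p.2 / α i else 0 :=
      (by fun_prop : Measurable fun p : (ℝ × ℝ) × ℝ => p.1.1).add
        (Measurable.ite (measurableSet_lt measurable_const (by fun_prop)) (by fun_prop)
          measurable_const)
    have := hm.comp_aemeasurable (((hZm i).prodMk hYm).prodMk hV.aemeasurable)
    exact this.congr ((hX i).mono fun ω hω => hω.symm)
  have hprob : ∀ i, IsProbabilityMeasure (P.map (X i)) := fun i =>
    Measure.isProbabilityMeasure_map (hXm i)
  have hatom : ∀ i, NullSingletonClass (P.map (X i)) := fun i => ⟨fun t => by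
    rw [Measure.map_apply_of_aemeasurable (hXm i) (measurableSet_singleton t)]
    exact measure_eq_zero_of_factor (hα i) hV (hZm i)
      (hind.comp (φ := id) (ψ := fun p : (Fin d → ℝ) × ℝ => p.1 i) measurable_id (by fun_prop))
      (hX i) (hZ0 i) t⟩
  have htail : ∀ i, Tendsto (fun b => b⁻¹ * P.real {ω | Real.exp (-(α i * X i ω)) < b}) (𝓝[>] 0)
      (𝓝 (K i)) := fun i => by
    -- The marginal tail is the joint tail theorem for a one-element index set, with `r = b⁻¹`.
    have h := tendsto_mul_measureReal_exists_exp_lt (κ := Unit) (P := P) (α := fun _ => α i)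
      (Z := fun _ => Z i) (X := fun _ => X i) (Y := Y) (V := V) (c := c) (l := 𝓝[>] (0 : ℝ))
      (r := fun b => b⁻¹) (bs := fun b _ => b) (β := fun _ => 1) (fun _ => hα i) hV
      ((aemeasurable_pi_lambda _ fun _ => hZm i).prodMk hYm)
      (hind.comp (φ := id) (ψ := fun p : (Fin d → ℝ) × ℝ => ((fun _ => p.1 i), p.2))
        measurable_id (by fun_prop)) (fun _ => hX i) (fun _ => hint i)
      tendsto_inv_nhdsGT_zero
      (eventually_mem_nhdsWithin.mono fun b hb _ => (Set.mem_Ioi.1 hb).le)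
      (fun _ => tendsto_const_nhds.congr' (eventually_mem_nhdsWithin.mono fun b hb =>
        (inv_mul_cancel₀ (Set.mem_Ioi.1 hb).ne').symm))
    simp only [exists_const, maxExp_unit, one_mul, hK] at h
    exact h
  set q : ℕ → Fin d → EReal := fun n i => quantile (cdf (P.map (X i))) (1 - x i / n) with hq
  -- The threshold 0 makes an exceedance impossible. It is set separately when `x i = 0` because the
  -- quantile may then be `+∞`, for which `toReal` returns 0.
  set b : ℕ → Fin d → ℝ := fun n i =>
    if x i = 0 then 0 else Real.exp (-(α i * (q n i).toReal)) with hb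
  have hb0 : ∀ n i, 0 ≤ b n i := fun n i => by
    simp only [hb]
    split_ifs
    · exact le_rfl
    · exact (Real.exp_pos _).le
  have hlarge : ∀ᶠ n : ℕ in atTop, ∀ i, x i / n < 1 := eventually_all.2 fun i =>
    (tendsto_const_div_atTop_nhds_zero_nat (x i)).eventually_lt_const one_pos
  have hquant : ∀ᶠ n : ℕ in atTop, ∀ i, x i ≠ 0 →
      q n i = ((q n i).toReal : EReal) ∧ n * P.real {ω | (q n i).toReal < X i ω} = x i := by
    filter_upwards [hlarge, eventually_gt_atTop 0] with n hn hpos i hi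
    have hn0 : (0 : ℝ) < n := by exact_mod_cast hpos
    have hxi : 0 < x i := lt_of_le_of_ne (hx i) (Ne.symm hi)
    obtain ⟨t, ht, htc⟩ := exists_quantile_eq (μ := P.map (X i)) (sub_pos.2 (hn i))
      (sub_lt_self 1 (div_pos hxi hn0))
    have hqt : q n i = t := ht
    rw [hqt, EReal.toReal_coe]
    refine ⟨rfl, ?_⟩
    have hc : P.real {ω | t < X i ω} = 1 - cdf (P.map (X i)) t := by
      rw [cdf_eq_real, ← probReal_compl_eq_one_sub measurableSet_Iic,
        map_measureReal_apply_of_aemeasurable (hXm i) measurableSet_Iic.compl]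
      congr 1
      ext ω
      simp
    rw [hc, htc]
    field_simp
    ring
  have hiff : ∀ i (t : ℝ) ω, Real.exp (-(α i * X i ω)) < Real.exp (-(α i * t)) ↔ t < X i ω :=
    fun i t ω => by rw [Real.exp_lt_exp, neg_lt_neg_iff, mul_lt_mul_iff_right₀ (hα i)]
  have hblim : ∀ i, Tendsto (fun n : ℕ => (n : ℝ) * b n i) atTop (𝓝 (x i / K i)) := fun i => by
    by_cases hi : x i = 0
    · simp [hb, hi]
    · refine tendsto_mul_exp_neg_of_tail (hKpos i) (htail i) (fun n => ?_) ?_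
      · simp only [hb, if_neg hi]
        exact Real.exp_pos _
      · filter_upwards [hquant] with n hn
        simp only [hb, if_neg hi, hiff]
        exact (hn i hi).2
  have hmain := tendsto_mul_measureReal_exists_exp_lt (l := atTop) (r := fun n : ℕ => (n : ℝ))
    hα hV hZY hind hX hint tendsto_natCast_atTop_atTop (Eventually.of_forall hb0) hblim
  refine hmain.congr' ?_
  filter_upwards [hquant] with n hn
  congr 1
  have hnull : ∀ i, x i = 0 → ∀ᵐ ω ∂P, (X i ω : EReal) ≤ q n i := fun i hi => by
    have h0 := measure_quantile_one_lt (μ := P.map (X i))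
    have hms : MeasurableSet {t : ℝ | quantile (cdf (P.map (X i))) 1 < t} :=
      measurableSet_lt measurable_const measurable_coe_real_ereal
    rw [Measure.map_apply_of_aemeasurable (hXm i) hms] at h0
    refine measure_mono_null (fun ω hω => ?_) h0
    have : ¬ (X i ω : EReal) ≤ q n i := hω
    simpa [hq, hi] using this
  have hle : ∀ i, NullMeasurableSet {ω | (X i ω : EReal) ≤ q n i} P := fun i =>
    nullMeasurableSet_le (measurable_coe_real_ereal.comp_aemeasurable (hXm i)) aemeasurable_const
  have hall : NullMeasurableSet {ω | ∀ i, (X i ω : EReal) ≤ q n i} P := by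
    rw [Set.ofPred_forall]
    exact NullMeasurableSet.iInter hle
  change _ = 1 - P.real {ω | ∀ i, (X i ω : EReal) ≤ q n i}
  rw [← probReal_compl_eq_one_sub₀ hall]
  refine measureReal_congr ?_
  filter_upwards [ae_all_iff.2 fun i => eventually_imp_distrib_left.2 (hnull i)] with ω hω
  simp only [eq_iff_iff]
  change (∃ i, Real.exp (-(α i * X i ω)) < b n i) ↔ ¬ ∀ i, (X i ω : EReal) ≤ q n i
  rw [not_forall]
  refine exists_congr fun i => ?_
  by_cases hi : x i = 0
  · simp only [hb, if_pos hi, hω i hi, not_true_eq_false, iff_false, not_lt]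
    exact (Real.exp_pos _).le
  · simp only [hb, if_neg hi, hiff, not_le]
    rw [(hn i hi).1, EReal.coe_lt_coe_iff, EReal.toReal_coe]

/-! ### Splitting the limit by the maximizing coordinate -/

/-- Almost surely only one index contributes. Ties need excluding only between positive weights,
since a maximizing term with zero weight adds nothing. -/
lemma integral_maxExp_eq_sum {Ω κ : Type*} [Fintype κ] [Nonempty κ] [MeasurableSpace Ω]
    {P : Measure Ω} {Z : κ → Ω → ℝ} {Y : Ω → ℝ} {α β : κ → ℝ} {c : ℝ}
    (hZY : AEMeasurable (fun ω => ((fun i => Z i ω), Y ω)) P) (hβ : ∀ i, 0 ≤ β i)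
    (hint : ∀ i, Integrable (fun ω => Real.exp (α i * Z i ω)) P)
    (hties : ∀ i j, i ≠ j → 0 < β i → 0 < β j →
      ∀ᵐ ω ∂P, β i * Real.exp (α i * Z i ω) ≠ β j * Real.exp (α j * Z j ω)) :
    ∫ ω, (if c < Y ω then maxExp α β (fun i => Z i ω) else 0) ∂P =
      ∑ j, ∫ ω, {p : (κ → ℝ) × ℝ | c < p.2 ∧ ∀ i, i ≠ j →
        β i * Real.exp (α i * p.1 i) ≤ β j * Real.exp (α j * p.1 j)}.indicator
          (fun p => β j * Real.exp (α j * p.1 j)) ((fun i => Z i ω), Y ω) ∂P := by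
  classical
  have hm : ∀ j, MeasurableSet {p : (κ → ℝ) × ℝ | c < p.2 ∧ ∀ i, i ≠ j →
      β i * Real.exp (α i * p.1 i) ≤ β j * Real.exp (α j * p.1 j)} := fun j => by
    simp only [Set.ofPred_and, Set.ofPred_forall]
    exact (measurableSet_lt (by fun_prop) (by fun_prop)).inter
      (MeasurableSet.iInter fun i => MeasurableSet.iInter fun _ =>
        measurableSet_le (by fun_prop) (by fun_prop))
  rw [← integral_finsetSum]
  · have hties' : ∀ᵐ ω ∂P, ∀ i j, i ≠ j → 0 < β i → 0 < β j →
        β i * Real.exp (α i * Z i ω) ≠ β j * Real.exp (α j * Z j ω) := by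
      simp only [ae_all_iff]
      exact hties
    refine integral_congr_ae ?_
    filter_upwards [hties'] with ω hω
    by_cases hc : c < Y ω
    · simp only [hc, if_true]
      obtain ⟨j₀, -, hj₀⟩ := Finset.exists_mem_eq_sup' (Finset.univ_nonempty (α := κ))
        fun i => β i * Real.exp (α i * Z i ω)
      have hmax : ∀ i, β i * Real.exp (α i * Z i ω) ≤ β j₀ * Real.exp (α j₀ * Z j₀ ω) :=
        fun i => hj₀ ▸ le_maxExp α β (fun i => Z i ω) i
      rw [Finset.sum_eq_single j₀]
      · rw [Set.indicator_of_mem (by exact ⟨hc, fun i _ => hmax i⟩)]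
        exact hj₀
      · intro j _ hj
        refine Set.indicator_apply_eq_zero.2 fun hmem => ?_
        have heq := le_antisymm (hmax j) (hmem.2 j₀ hj.symm)
        rcases (hβ j).eq_or_lt with h0 | h0
        · simp [← h0]
        · rcases (hβ j₀).eq_or_lt with h1 | h1
          · rw [heq, ← h1, zero_mul]
          · exact absurd heq (hω j j₀ hj h0 h1)
      · simp
    · simp [hc]
  · intro j _
    refine Integrable.mono' ((hint j).const_mul (β j)) ?_ (ae_of_all _ fun ω => ?_)
    · exact ((Measurable.indicator (by fun_prop) (hm j)).comp_aemeasurable hZY).aestronglyMeasurable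
    · have h0 : 0 ≤ β j * Real.exp (α j * Z j ω) := mul_nonneg (hβ j) (Real.exp_pos _).le
      refine (norm_indicator_le_norm_self _ _).trans ?_
      rw [Real.norm_of_nonneg h0]

/-! ### Gaussian evaluation of the summands -/

section GaussianVector

variable {Ω : Type*} [MeasurableSpace Ω] {P : Measure Ω}

lemma measureReal_lt_of_gaussian {W : Ω → ℝ} (h : HasGaussianLaw W P) (hm : ∫ ω, W ω ∂P = 0)
    (hv : Var[W; P] = 1) (s : ℝ) : P.real {ω | s < W ω} = stdNormalCdf (-s) := by
  have hl : HasLaw W (gaussianReal 0 (1 : ℝ).toNNReal) P :=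
    ⟨h.aemeasurable, by rw [h.map_eq_gaussianReal, hm, hv]⟩
  refine (hl.measureReal_eq (p := fun x => s < x) measurableSet_Ioi).trans ?_
  have := gaussianReal_Ioi one_pos s
  rw [Real.sqrt_one, div_one] at this
  exact (congrArg ENNReal.toReal this).trans (ENNReal.toReal_ofReal (stdNormalCdf_pos _).le)

lemma measure_eq_zero_of_gaussian {W : Ω → ℝ} (h : HasGaussianLaw W P) (hv : 0 < Var[W; P])
    (t : ℝ) : P {ω | W ω = t} = 0 := by
  have hl : HasLaw W _ P := ⟨h.aemeasurable, h.map_eq_gaussianReal⟩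
  have := nullSingletonClass_gaussianReal (μ := ∫ ω, W ω ∂P) (Real.toNNReal_pos.2 hv).ne'
  exact (hl.measure_eq (p := fun x => x = t) (measurableSet_singleton t)).trans
    (measure_singleton t)

lemma integrable_exp_mul_of_gaussian {W : Ω → ℝ} (h : HasGaussianLaw W P) (a : ℝ) :
    Integrable (fun ω => Real.exp (a * W ω)) P := by
  have hi := integrable_exp_mul_gaussianReal (μ := ∫ ω, W ω ∂P) (v := Var[W; P].toNNReal) a
  rw [← h.map_eq_gaussianReal] at hi
  exact hi.comp_aemeasurable h.aemeasurable

variable [IsProbabilityMeasure P] {d : ℕ}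
  {Z : Fin d → Ω → ℝ} {Y : Ω → ℝ} {α : Fin d → ℝ} {ρ : Fin d → Fin d → ℝ} {ρ₀ : Fin d → ℝ}

/-- The Cameron–Martin formula for `(Z, Y)` in the direction of `Z j`. -/
lemma integral_indicator_exp_of_gaussian
    (h : HasGaussianLaw (fun ω => ((fun i => Z i ω), Y ω)) P)
    (hm : ∀ i, ∫ ω, Z i ω ∂P = 0) (hv : ∀ i, Var[Z i; P] = 1)
    (hρ : ∀ i j, ρ i j = cov[Z i, Z j; P]) (hρ₀ : ∀ i, ρ₀ i = cov[Z i, Y; P])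
    (j : Fin d) {b : ℝ} (hb : 0 ≤ b) {A : Set ((Fin d → ℝ) × ℝ)} (hA : MeasurableSet A) :
    ∫ ω, A.indicator (fun p => b * Real.exp (α j * p.1 j)) ((fun i => Z i ω), Y ω) ∂P =
      b * Real.exp (α j ^ 2 / 2) *
        P.real {ω | ((fun i => Z i ω + α j * ρ i j), Y ω + α j * ρ₀ j) ∈ A} := by
  have hZY := h.aemeasurable
  -- The index `none` carries `Y`, so that one tilt by `Z j` shifts `Y` and all of `Z` together.
  set R : Option (Fin d) → Ω → ℝ := fun k => k.elim Y Z with hR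
  let L : (Fin d → ℝ) × ℝ →L[ℝ] ℝ × (Option (Fin d) → ℝ) :=
    ((ContinuousLinearMap.proj j).comp (ContinuousLinearMap.fst ℝ (Fin d → ℝ) ℝ)).prod
      (ContinuousLinearMap.pi fun k => k.elim (ContinuousLinearMap.snd ℝ (Fin d → ℝ) ℝ)
        fun i => (ContinuousLinearMap.proj i).comp (ContinuousLinearMap.fst ℝ (Fin d → ℝ) ℝ))
  have hL : HasGaussianLaw (fun ω => (Z j ω, fun k => R k ω)) P := by
    convert! h.map_fun L using 1
    ext ω : 1
    refine Prod.ext rfl ?_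
    ext k
    cases k <;> rfl
  have hφ : Measurable fun r : Option (Fin d) → ℝ => ((fun i => r (some i)), r none) := by
    fun_prop
  have key := lintegral_exp_mul_gaussian hL (hm j) (hv j) (α j)
    (f := fun r => A.indicator 1 ((fun i => r (some i)), r none))
    ((measurable_one.indicator hA).comp hφ)
  have hshift : AEMeasurable (fun ω => ((fun i => Z i ω + α j * ρ i j), Y ω + α j * ρ₀ j)) P :=
    (show Measurable fun p : (Fin d → ℝ) × ℝ => ((fun i => p.1 i + α j * ρ i j),
      p.2 + α j * ρ₀ j) by fun_prop).comp_aemeasurable hZY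
  have hright : ∫⁻ ω, A.indicator 1 ((fun i => Z i ω + α j * ρ i j), Y ω + α j * ρ₀ j) ∂P =
      P {ω | ((fun i => Z i ω + α j * ρ i j), Y ω + α j * ρ₀ j) ∈ A} := by
    refine Eq.trans ?_ (lintegral_indicator_one₀ (hshift.nullMeasurableSet_preimage hA))
    rfl
  simp only [hR, Option.elim_none, Option.elim_some, ← hρ, covariance_comm Y, ← hρ₀,
    hright] at key
  rw [integral_eq_lintegral_of_nonneg_ae]
  · rw [mul_assoc, measureReal_def, ← ENNReal.toReal_ofReal (Real.exp_pos (α j ^ 2 / 2)).le,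
      ← ENNReal.toReal_mul, ← key, ← ENNReal.toReal_ofReal hb, ← ENNReal.toReal_mul,
      ← lintegral_const_mul' _ _ ENNReal.ofReal_ne_top, ENNReal.toReal_ofReal hb]
    congr 1
    refine lintegral_congr fun ω => ?_
    by_cases hω : ((fun i => Z i ω), Y ω) ∈ A
    · simp [hω, ENNReal.ofReal_mul hb]
    · simp [hω]
  · exact ae_of_all _ fun ω => Set.indicator_nonneg
      (fun p _ => mul_nonneg hb (Real.exp_pos _).le) _
  · exact ((Measurable.indicator (by fun_prop) hA).comp_aemeasurable hZY).aestronglyMeasurable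

/-- The constant `lim exp(α_j t) P(X_j > t)`. -/
lemma integral_ite_exp_of_gaussian
    (h : HasGaussianLaw (fun ω => ((fun i => Z i ω), Y ω)) P)
    (hm : ∀ i, ∫ ω, Z i ω ∂P = 0) (hv : ∀ i, Var[Z i; P] = 1)
    (hmY : ∫ ω, Y ω ∂P = 0) (hvY : Var[Y; P] = 1)
    (hρ₀ : ∀ i, ρ₀ i = cov[Z i, Y; P]) (c : ℝ) (j : Fin d) :
    ∫ ω, (if c < Y ω then Real.exp (α j * Z j ω) else 0) ∂P =
      Real.exp (α j ^ 2 / 2) * stdNormalCdf (α j * ρ₀ j - c) := by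
  have key := integral_indicator_exp_of_gaussian (α := α) h hm hv (fun _ _ => rfl) hρ₀ j
    zero_le_one (A := {p | c < p.2}) (measurableSet_lt (by fun_prop) (by fun_prop))
  simp only [one_mul] at key
  have hset : {ω | ((fun i => Z i ω + α j * cov[Z i, Z j; P]), Y ω + α j * ρ₀ j) ∈
      {p : (Fin d → ℝ) × ℝ | c < p.2}} = {ω | c - α j * ρ₀ j < Y ω} := by
    ext ω
    simp [sub_lt_iff_lt_add]
  rw [hset, measureReal_lt_of_gaussian h.snd hmY hvY, neg_sub] at key
  rw [← key]
  rfl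

/-- Positivity of the square root rules out a negative radicand, where `√` would take its default
value 0. -/
lemma hrLambda_sq {i j : Fin d} (h : 0 < hrLambda α ρ i j) :
    hrLambda α ρ i j ^ 2 = α i ^ 2 - 2 * ρ i j * α i * α j + α j ^ 2 :=
  Real.sq_sqrt (Real.sqrt_pos.1 h).le

lemma covariance_mul_sub_mul (h : ∀ i, MemLp (Z i) 2 P) (hρ : ∀ i j, ρ i j = cov[Z i, Z j; P])
    (i k j : Fin d) :
    cov[fun ω => α i * Z i ω - α j * Z j ω, fun ω => α k * Z k ω - α j * Z j ω; P] =
      α i * α k * ρ i k - α i * α j * ρ i j - α j * α k * ρ j k + α j ^ 2 * ρ j j := by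
  rw [covariance_fun_sub_fun_sub ((h i).const_mul _) ((h j).const_mul _) ((h k).const_mul _)
    ((h j).const_mul _)]
  simp only [covariance_const_mul_left, covariance_const_mul_right, ← hρ]
  ring

/-- One summand of the stable tail dependence function. -/
lemma integral_indicator_argmax_eq_esnCdf
    (h : HasGaussianLaw (fun ω => ((fun i => Z i ω), Y ω)) P)
    (hm : ∀ i, ∫ ω, Z i ω ∂P = 0) (hv : ∀ i, Var[Z i; P] = 1)
    (hmY : ∫ ω, Y ω ∂P = 0) (hvY : Var[Y; P] = 1)
    (hρ : ∀ i j, ρ i j = cov[Z i, Z j; P]) (hρ₀ : ∀ i, ρ₀ i = cov[Z i, Y; P])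
    (hlam : ∀ i j, i ≠ j → 0 < hrLambda α ρ i j) (c : ℝ) (j : Fin d)
    (hdet : IsUnit (hrMatrix α ρ j).det) (hquad : skewQuad α ρ ρ₀ j < 1)
    {x β : Fin d → ℝ} (hx : ∀ i, 0 ≤ x i)
    (hβ : ∀ i, β i = x i / (Real.exp (α i ^ 2 / 2) * stdNormalCdf (α i * ρ₀ i - c))) :
    ∫ ω, {p : (Fin d → ℝ) × ℝ | c < p.2 ∧ ∀ i, i ≠ j →
        β i * Real.exp (α i * p.1 i) ≤ β j * Real.exp (α j * p.1 j)}.indicator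
          (fun p => β j * Real.exp (α j * p.1 j)) ((fun i => Z i ω), Y ω) ∂P =
      x j * esnCdf (hrMatrix α ρ j)
        ((1 / √(1 - skewQuad α ρ ρ₀ j)) • ((hrMatrix α ρ j)⁻¹ *ᵥ skewDelta α ρ ρ₀ j))
        ((α j * ρ₀ j - c) / √(1 - skewQuad α ρ ρ₀ j)) (esnArgument α ρ ρ₀ c x j) := by
  have hΦ : ∀ i, 0 < stdNormalCdf (α i * ρ₀ i - c) := fun i => stdNormalCdf_pos _
  rcases (hx j).eq_or_lt with hxj | hxj
  · simp [hβ j, ← hxj]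
  have hβ0 : ∀ i, 0 ≤ β i := fun i => by
    rw [hβ]
    exact div_nonneg (hx i) (mul_pos (Real.exp_pos _) (hΦ i)).le
  have hZ2 : ∀ i, MemLp (Z i) 2 P := fun i => (h.fst.eval i).memLp_two
  have hρself : ∀ i, ρ i i = 1 := fun i => by
    rw [hρ, covariance_self (hZ2 i).aemeasurable, hv]
  have hρsymm : ∀ i k, ρ i k = ρ k i := fun i k => by rw [hρ, hρ, covariance_comm]
  have hA : MeasurableSet {p : (Fin d → ℝ) × ℝ | c < p.2 ∧ ∀ i, i ≠ j →
      β i * Real.exp (α i * p.1 i) ≤ β j * Real.exp (α j * p.1 j)} := by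
    simp only [Set.ofPred_and, Set.ofPred_forall]
    exact (measurableSet_lt (by fun_prop) (by fun_prop)).inter
      (MeasurableSet.iInter fun i => MeasurableSet.iInter fun _ =>
        measurableSet_le (by fun_prop) (by fun_prop))
  rw [integral_indicator_exp_of_gaussian h hm hv hρ hρ₀ j (hβ0 j) hA]
  set R : {i : Fin d // i ≠ j} → Ω → ℝ := fun i ω =>
    (α i * Z i ω - α j * Z j ω) / hrLambda α ρ i j with hR
  have hRlaw : HasGaussianLaw (fun ω => (Y ω, fun i => R i ω)) P := by
    let L : (Fin d → ℝ) × ℝ →L[ℝ] ℝ × ({i : Fin d // i ≠ j} → ℝ) :=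
      (ContinuousLinearMap.snd ℝ (Fin d → ℝ) ℝ).prod (ContinuousLinearMap.pi fun i =>
        (hrLambda α ρ i j)⁻¹ • (α i • (ContinuousLinearMap.proj (i : Fin d)).comp
          (ContinuousLinearMap.fst ℝ (Fin d → ℝ) ℝ) - α j • (ContinuousLinearMap.proj j).comp
          (ContinuousLinearMap.fst ℝ (Fin d → ℝ) ℝ)))
    convert! h.map_fun L using 1
    ext ω : 1
    refine Prod.ext rfl ?_
    ext i
    simp [L, hR, div_eq_inv_mul]
  have hRm : ∀ i, ∫ ω, R i ω ∂P = 0 := fun i => by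
    simp only [hR]
    rw [integral_div, integral_sub ((h.fst.eval i).integrable.const_mul _)
      ((h.fst.eval j).integrable.const_mul _), integral_const_mul, integral_const_mul, hm, hm]
    simp
  have hcov : ∀ i k, cov[R i, R k; P] = hrMatrix α ρ j i k := fun i k => by
    simp only [hR]
    rw [covariance_fun_div_left, covariance_fun_div_right, covariance_mul_sub_mul hZ2 hρ]
    have hi := hlam i j i.2
    have hk := hlam k j k.2
    have hi2 := hrLambda_sq hi
    have hk2 := hrLambda_sq hk
    rw [hrMatrix, Matrix.of_apply]
    split_ifs with hik
    · subst hik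
      rw [div_div, div_eq_one_iff_eq (by positivity), ← sq (hrLambda α ρ i j), hi2, hρself, hρself, hρsymm j i]
      ring
    · have hki := hrLambda_sq (hlam k i fun e => hik (Subtype.ext e.symm))
      rw [div_div, div_eq_div_iff (by positivity) (by positivity), hi2, hk2, hki, hρself,
        hρsymm j k, hρsymm k i]
      ring
  have hδ : ∀ i, cov[R i, Y; P] = skewDelta α ρ ρ₀ j i := fun i => by
    simp only [hR, skewDelta]
    rw [covariance_fun_div_left, covariance_fun_sub_left ((hZ2 i).const_mul _)
      ((hZ2 j).const_mul _) h.snd.memLp_two, covariance_const_mul_left,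
      covariance_const_mul_left, ← hρ₀, ← hρ₀]
  have hesn := measureReal_lt_and_le_eq_esnCdf hRlaw hRm hmY hcov
    (fun i => by simp [hrMatrix]) hdet hδ hvY hquad (c - α j * ρ₀ j) (esnArgument α ρ ρ₀ c x j)
  rw [neg_sub] at hesn
  -- Here `log β_k = log x̃_k - α_k² / 2` for `x_k > 0`. After the shift, the comparison of terms
  -- `i` and `j` becomes `α_i Z_i - α_j Z_j ≤ log(x̃_j / x̃_i) + λ_ij² / 2`; dividing by `λ_ij`
  -- gives the stated argument. If `x_i = 0` the comparison always holds, matching `⊤`.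
  have hset : {ω | ((fun i => Z i ω + α j * ρ i j), Y ω + α j * ρ₀ j) ∈
      {p : (Fin d → ℝ) × ℝ | c < p.2 ∧ ∀ i, i ≠ j →
        β i * Real.exp (α i * p.1 i) ≤ β j * Real.exp (α j * p.1 j)}} =
      {ω | c - α j * ρ₀ j < Y ω ∧ ∀ i, (R i ω : EReal) ≤ esnArgument α ρ ρ₀ c x j i} := by
    ext ω
    simp only [Set.mem_ofPred_eq, sub_lt_iff_lt_add, Subtype.forall]
    refine and_congr_right fun _ => forall_congr' fun i => forall_congr' fun hij => ?_
    unfold esnArgument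
    split_ifs with hxi
    · simp only [hβ i, hxi, zero_div, zero_mul, le_top, iff_true]
      exact mul_nonneg (hβ0 j) (Real.exp_pos _).le
    have hxi' : 0 < x i := lt_of_le_of_ne (hx i) (Ne.symm hxi)
    have hl := hlam i j hij
    have hxt : ∀ k, 0 < x k → 0 < xTilde α ρ₀ c x k := fun k hk => div_pos hk (hΦ k)
    have hexp : ∀ k, 0 < x k → ∀ z, β k * Real.exp z =
        Real.exp (Real.log (xTilde α ρ₀ c x k) - α k ^ 2 / 2 + z) := fun k hk z => by
      rw [Real.exp_add, Real.exp_sub, Real.exp_log (hxt k hk), hβ, xTilde, div_div,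
        mul_comm (Real.exp _)]
    rw [hexp i hxi', hexp j hxj, Real.exp_le_exp, EReal.coe_le_coe_iff,
      Real.log_div (hxt j hxj).ne' (hxt i hxi').ne', hR, div_le_iff₀ hl,
      add_mul, mul_right_comm, one_div_mul_cancel hl.ne', div_mul_eq_mul_div, ← sq (hrLambda α ρ i j),
      hrLambda_sq hl, hρself, one_mul]
    constructor <;> intro hle <;> linarith
  rw [hset, hesn, ← mul_assoc]
  congr 1
  rw [hβ]
  have := (hΦ j).ne'
  field_simp

/-- Distinct weighted log-normal coordinates almost surely differ. -/
lemma ae_mul_exp_ne_of_gaussian (h : HasGaussianLaw (fun ω i => Z i ω) P)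
    (hv : ∀ i, Var[Z i; P] = 1) (hρ : ∀ i j, ρ i j = cov[Z i, Z j; P]) {i j : Fin d}
    (hlam : 0 < hrLambda α ρ i j) {b b' : ℝ} (hb : 0 < b) (hb' : 0 < b') :
    ∀ᵐ ω ∂P, b * Real.exp (α i * Z i ω) ≠ b' * Real.exp (α j * Z j ω) := by
  have hZ2 : ∀ i, MemLp (Z i) 2 P := fun i => (h.eval i).memLp_two
  have hρself : ∀ i, ρ i i = 1 := fun i => by
    rw [hρ, covariance_self (hZ2 i).aemeasurable, hv]
  have hD : HasGaussianLaw (fun ω => α i * Z i ω - α j * Z j ω) P :=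
    h.map_fun (α i • ContinuousLinearMap.proj i - α j • ContinuousLinearMap.proj j :
      (Fin d → ℝ) →L[ℝ] ℝ)
  -- This variance is `λ_ij²`, so the difference is nondegenerate and has no atoms.
  have hDv : 0 < Var[fun ω => α i * Z i ω - α j * Z j ω; P] := by
    rw [← covariance_self hD.aemeasurable, covariance_mul_sub_mul hZ2 hρ, hρself, hρself,
      show ρ j i = ρ i j by rw [hρ, hρ, covariance_comm]]
    have := hrLambda_sq hlam
    nlinarith [pow_pos hlam 2]
  refine measure_mono_null (fun ω hω => ?_)
    (measure_eq_zero_of_gaussian hD hDv (Real.log b' - Real.log b))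
  have heq : b * Real.exp (α i * Z i ω) = b' * Real.exp (α j * Z j ω) := not_not.1 hω
  have hlog := congrArg Real.log heq
  rw [Real.log_mul hb.ne' (Real.exp_pos _).ne', Real.log_mul hb'.ne' (Real.exp_pos _).ne',
    Real.log_exp, Real.log_exp] at hlog
  change α i * Z i ω - α j * Z j ω = _
  linarith

end GaussianVector

end

/-! ### Assembly of the limit -/

theorem proposition4 {Ω : Type*} [MeasurableSpace Ω] (P : Measure Ω) [IsProbabilityMeasure P]
    (d : ℕ) (α c : Fin d → ℝ) (Z Zs : Fin d → Ω → ℝ) (V₀ : Ω → ℝ)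
    (hα : ∀ i, 0 < α i)
    -- `(Z, Z*)` is jointly Gaussian with zero means and unit variances
    (hgauss : HasGaussianLaw (fun ω => ((fun i => Z i ω), (fun i => Zs i ω))) P)
    (hmean : ∀ i, ∫ ω, Z i ω ∂P = 0) (hmeans : ∀ i, ∫ ω, Zs i ω ∂P = 0)
    (hvar : ∀ i, Var[Z i; P] = 1) (hvars : ∀ i, Var[Zs i; P] = 1)
    -- the common factor is unit exponential and independent of `(Z, Z*)`
    (hV₀ : HasLaw V₀ (expMeasure 1) P)
    (hindep : IndepFun V₀ (fun ω => ((fun i => Z i ω), (fun i => Zs i ω))) P)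
    -- common truncation level and common truncation variable
    (c₀ : ℝ) (hc : ∀ i, c i = c₀) (Z₀ : Ω → ℝ) (hZs : ∀ i, Zs i =ᵐ[P] Z₀)
    (ρ : Fin d → Fin d → ℝ) (hρ : ∀ i j, ρ i j = correlation P (Z i) (Z j))
    (ρ₀ : Fin d → ℝ) (hρ₀ : ∀ i, ρ₀ i = correlation P (Z i) Z₀)
    -- the parameters of the limit are well defined
    (hlam : ∀ i j, i ≠ j → 0 < hrLambda α ρ i j)
    (hdet : ∀ j, IsUnit (hrMatrix α ρ j).det)
    (hquad : ∀ j, skewQuad α ρ ρ₀ j < 1) :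
    IsStableTailDependenceFunction P (factorModel α c Z Zs V₀) (fun x =>
      ∑ j, x j * esnCdf (hrMatrix α ρ j)
        ((1 / √(1 - skewQuad α ρ ρ₀ j)) • ((hrMatrix α ρ j)⁻¹ *ᵥ skewDelta α ρ ρ₀ j))
        ((α j * ρ₀ j - c₀) / √(1 - skewQuad α ρ ρ₀ j))
        (esnArgument α ρ ρ₀ c₀ x j)) := by
  intro x hx
  rcases isEmpty_or_nonempty (Fin d) with hd | ⟨⟨i₀⟩⟩
  -- For `d = 0` the copula is identically 1 and the sum is empty.
  · simp [copula]
  have : Nonempty (Fin d) := ⟨i₀⟩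
  have hG : HasGaussianLaw (fun ω => ((fun i => Z i ω), Zs i₀ ω)) P :=
    hgauss.map_fun ((ContinuousLinearMap.fst ℝ (Fin d → ℝ) (Fin d → ℝ)).prod
      ((ContinuousLinearMap.proj i₀).comp (ContinuousLinearMap.snd ℝ (Fin d → ℝ) (Fin d → ℝ))))
  have hind : IndepFun V₀ (fun ω => ((fun i => Z i ω), Zs i₀ ω)) P :=
    hindep.comp (φ := id) (ψ := fun p : (Fin d → ℝ) × (Fin d → ℝ) => (p.1, p.2 i₀))
      measurable_id (by fun_prop)
  have hcov : ∀ i j, ρ i j = cov[Z i, Z j; P] := fun i j => by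
    rw [hρ, correlation, hvar, hvar]
    simp
  -- Joint Gaussianity is known for `Zs i₀` and not directly for `Z₀`, so `Zs i₀` serves as the
  -- common truncation variable; the moments agree by almost sure equality.
  have hcov₀ : ∀ i, ρ₀ i = cov[Z i, Zs i₀; P] := fun i => by
    have hcongr : cov[Z i, Z₀; P] = cov[Z i, Zs i₀; P] := by
      simp only [covariance, ← integral_congr_ae (hZs i₀)]
      refine integral_congr_ae ?_
      filter_upwards [hZs i₀] with ω hω
      rw [hω]
    rw [hρ₀, correlation, ← variance_congr (hZs i₀), hvar, hvars, hcongr]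
    simp
  have hX : ∀ i, ∀ᵐ ω ∂P, factorModel α c Z Zs V₀ i ω =
      Z i ω + if c₀ < Zs i₀ ω then V₀ ω / α i else 0 := fun i => by
    filter_upwards [hZs i, hZs i₀] with ω h1 h2
    simp only [factorModel, Set.indicator_apply, Set.mem_ofPred_eq, hc i, h1, h2]
    split_ifs <;> ring
  have hint : ∀ i, Integrable (fun ω => Real.exp (α i * Z i ω)) P := fun i =>
    integrable_exp_mul_of_gaussian (hG.fst.eval i) _
  have hKpos : ∀ i, 0 < Real.exp (α i ^ 2 / 2) * stdNormalCdf (α i * ρ₀ i - c₀) := fun i =>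
    mul_pos (Real.exp_pos _) (stdNormalCdf_pos _)
  have hmain := tendsto_mul_one_sub_copula hα hV₀ hG.aemeasurable hind hX hint
    (fun i => measure_eq_zero_of_gaussian (hG.fst.eval i) ((hvar i).symm ▸ one_pos))
    (integral_ite_exp_of_gaussian hG hmean hvar (hmeans i₀) (hvars i₀) hcov₀ c₀) hKpos hx
  rw [integral_maxExp_eq_sum hG.aemeasurable (fun i => div_nonneg (hx i) (hKpos i).le) hint
    fun i j hij hi hj => ae_mul_exp_ne_of_gaussian hG.fst hvar hcov (hlam i j hij) hi hj] at hmain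
  convert! hmain using 2
  exact Finset.sum_congr rfl fun j _ => (integral_indicator_argmax_eq_esnCdf hG hmean hvar
    (hmeans i₀) (hvars i₀) hcov hcov₀ hlam c₀ j (hdet j) (hquad j) hx fun _ => rfl).symm
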